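/- **Conventions.** $A\subseteq^* B$ means that $A\setminus B$ is finite, and $[S]^\omega$ denotes the family of all countably infinite subsets of $S$. For $f,g:\omega\to\omega$, $f\le^* g$ means that $f(n)\le g(n)$ for all but finitely many $n$. The bounding number $\mathfrak b$ is the least cardinality of an unbounded family in $(\omega^\omega,\le^*)$, and the dominating number $\mathfrak d$ is the least cardinality of a dominating family in $(\omega^\omega,\le^*)$. For an ideal $\mathcal I$ on a set $X$ put $$\mathrm{add}_\omega(\mathcal I)=\min\{|\mathcal A|:\mathcal A\subseteq\mathcal I\ \wedge\ \neg\exists\mathcal B\in[\mathcal I]^\omega\ \forall A\in\mathcal A\ \exists B\in\mathcal B\ (A\subseteq^* B)\},$$ $$\mathrm{non}_\omega(\mathcal I)=\min\{|\mathcal A|:\mathcal A\subseteq[X]^\omega\cap\mathcal I\ \wedge\ \forall\mathcal B\in[\mathcal I]^\omega\ \exists A\in\mathcal A\ \forall B\in\mathcal B\ (|A\cap B|<\aleph_0)\},$$ $$\mathrm{cof}_\omega(\mathcal I)=\min\{|\mathcal A|:\mathcal A\subseteq[\mathcal I]^\omega\ \wedge\ \forall\mathcal B\in[\mathcal I]^\omega\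 \exists\mathcal C\in\mathcal A\ \forall B\in\mathcal B\ \exists A\in\mathcal C\ (B\subseteq^* A)\},$$ with the convention $\min\emptyset=\mathfrak c^+$. Let $\{\emptyset\}\otimes\mathrm{FIN}$ be the ideal on $\omega\times\omega$ of all sets $A$ such that $\{j:(i,j)\in A\}$ is finite for every $i\in\omega$. For a countable ordinal $\alpha\ge 2$ let $\mathrm{conv}_\alpha$ be the ideal on $\omega^\alpha+1=\{\xi:\xi\le\omega^\alpha\}$ (ordinal exponentiation, order topology) of all sets that can be covered by the ranges of finitely many convergent sequences in $\omega^\alpha+1$. **Statement.** 1. $\mathrm{add}_\omega(\{\emptyset\}\otimes\mathrm{FIN})=\mathfrak b$ and $\mathrm{cof}_\omega(\{\emptyset\}\otimes\mathrm{FIN})=\mathrm{non}_\omega(\{\emptyset\}\otimes\mathrm{FIN})=\mathfrak d$. 2. For every countable ordinal $\alpha\ge 2$, $\mathrm{add}_\omega(\mathrm{conv}_\alpha)=\mathfrak b$ and $\mathrm{cof}_\omega(\mathrm{conv}_\alpha)=\mathrm{non}_\omega(\mathrm{conv}_\alpha)=\mathfrak d$. -/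

import Mathlib

open Filter Topology Set
open scoped Cardinal Ordinal

universe u

noncomputable section

/-- `f ≤* g`: there is `k` with `f n ≤ g n` for all `n ≥ k`. -/
def LEStar (f g : ℕ → ℕ) : Prop := ∃ k : ℕ, ∀ n, k ≤ n → f n ≤ g n

/-- `A ⊆* B`: the set `A \ B` is finite. -/
def SubsetStar {X : Type*} (A B : Set X) : Prop := (A \ B).Finite

/-- `[S]^ω`: the family of all countably infinite subsets of `S`. -/
def ctblInfSubsets {X : Type*} (S : Set X) : Set (Set X) :=
  {A | A ⊆ S ∧ A.Countable ∧ A.Infinite}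

/-- The bounding number `𝔟`: the least cardinality of an unbounded family in `(ω^ω, ≤*)`. -/
def boundingNumber : Cardinal.{0} :=
  sInf {κ | ∃ F : Set (ℕ → ℕ), #F = κ ∧ ¬ ∃ g : ℕ → ℕ, ∀ f ∈ F, LEStar f g}

/-- The dominating number `𝔡`: the least cardinality of a dominating family in `(ω^ω, ≤*)`. -/
def dominatingNumber : Cardinal.{0} :=
  sInf {κ | ∃ F : Set (ℕ → ℕ), #F = κ ∧ ∀ g : ℕ → ℕ, ∃ f ∈ F, LEStar g f}

open Classical in
/-- The minimum of a set of cardinals, with the convention `min ∅ = 𝔠⁺`. -/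
def minCard (S : Set Cardinal.{u}) : Cardinal.{u} :=
  if S.Nonempty then sInf S else Order.succ Cardinal.continuum

/-- The `ω`-additivity `add_ω(I)` of an ideal `I` on `X`. -/
def addOmega {X : Type u} (I : Set (Set X)) : Cardinal.{u} :=
  minCard {κ | ∃ 𝒜 : Set (Set X), #𝒜 = κ ∧ 𝒜 ⊆ I ∧
    ¬ ∃ ℬ ∈ ctblInfSubsets I, ∀ A ∈ 𝒜, ∃ B ∈ ℬ, SubsetStar A B}

/-- The `ω`-uniformity `non_ω(I)` of an ideal `I` on `X`. -/
def nonOmega {X : Type u} (I : Set (Set X)) : Cardinal.{u} :=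
  minCard {κ | ∃ 𝒜 : Set (Set X), #𝒜 = κ ∧ 𝒜 ⊆ ctblInfSubsets (univ : Set X) ∩ I ∧
    ∀ ℬ ∈ ctblInfSubsets I, ∃ A ∈ 𝒜, ∀ B ∈ ℬ, (A ∩ B).Finite}

/-- The `ω`-cofinality `cof_ω(I)` of an ideal `I` on `X`. -/
def cofOmega {X : Type u} (I : Set (Set X)) : Cardinal.{u} :=
  minCard {κ | ∃ 𝒜 : Set (Set (Set X)), #𝒜 = κ ∧ 𝒜 ⊆ ctblInfSubsets I ∧
    ∀ ℬ ∈ ctblInfSubsets I, ∃ C ∈ 𝒜, ∀ B ∈ ℬ, ∃ A ∈ C, SubsetStar B A}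

/-- The ideal `{∅} ⊗ FIN` on `ω × ω`. -/
def emptyTensorFin : Set (Set (ℕ × ℕ)) :=
  {A | ∀ i : ℕ, {j : ℕ | (i, j) ∈ A}.Finite}

/-- The ideal `conv(D)` for a subset `D` of a topological space `X`: all `A ⊆ D` that can be covered
by the ranges of finitely many sequences in `D` that converge in `X`. -/
def convIdeal {X : Type*} [TopologicalSpace X] (D : Set X) : Set (Set X) :=
  {A | A ⊆ D ∧ ∃ (k : ℕ) (d : Fin k → ℕ → X),
    (∀ i n, d i n ∈ D) ∧ (∀ i, ∃ x : X, Tendsto (d i) atTop (𝓝 x)) ∧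
    A ⊆ ⋃ i, range (d i)}

/-- The space `ω^α + 1 = {ξ : ξ ≤ ω^α}`. Its topology is the one induced from the ordinals, which
is its order topology. -/
abbrev OmegaPowSucc (α : Ordinal.{0}) : Type 1 := Iic ((ω : Ordinal.{0}) ^ α)

/-- The topology on `ω^α + 1` is the order topology. -/
theorem orderTopology_omegaPowSucc (α : Ordinal.{0}) : OrderTopology (OmegaPowSucc α) :=
  inferInstance

/-- The ideal `conv_α = conv(ω^α + 1)`. -/
def convAlpha (α : Ordinal.{0}) : Set (Set (OmegaPowSucc α)) :=
  convIdeal (univ : Set (OmegaPowSucc α))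

end

/-! ### Bounding and dominating families -/

/-! Both ideals are instances of `IsLayered`, and that structure alone determines the three
invariants. Points carry an injective index and, for each `s`, a level; sets bounding the index by a
function of the level generate the ideal. If `f ≤* g`, the set given by `f` is almost contained in
the one given by `g` (`layerSet_subsetStar`), so for countable `S` one function `g` yields a
countable family absorbing everything below it. This gives `𝔟 ≤ add_ω` and `cof_ω ≤ 𝔡`. Conversely,
the embedded copy of `ω × ω` reads one function off each countable subfamily of the ideal
(`exists_common_column_bound`). Testing it against regions below graphs gives `add_ω ≤ 𝔟` and `𝔡 ≤
cof_ω`; testing it against graphs gives `non_ω ≤ 𝔡`. The remaining bound `𝔡 ≤ non_ω` comes from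
`exists_escape_function`. For `conv_α` the level of `y` at `x` records how close `y` is to `x`: a
set converges to `x` when each of its levels is finite, the point `x` itself aside. -/

theorem LEStar.trans {f g h : ℕ → ℕ} (h₁ : LEStar f g) (h₂ : LEStar g h) : LEStar f h := by
  obtain ⟨k, hk⟩ := h₁
  obtain ⟨l, hl⟩ := h₂
  exact ⟨max k l, fun n hn => (hk n (le_trans (le_max_left _ _) hn)).trans
    (hl n (le_trans (le_max_right _ _) hn))⟩

theorem LEStar.of_le {f g : ℕ → ℕ} (h : ∀ n, f n ≤ g n) : LEStar f g := ⟨0, fun n _ => h n⟩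

theorem exists_leStar_of_countable {T : Type*} [Countable T] (h : T → ℕ → ℕ) :
    ∃ g : ℕ → ℕ, ∀ t, LEStar (h t) g := by
  obtain ⟨e, he⟩ := exists_injective_nat T
  have hfin : ∀ n, {t | e t ≤ n}.Finite := fun n => (finite_Iic n).preimage he.injOn
  refine ⟨fun n => (hfin n).toFinset.sup (fun t => h t n), fun t => ⟨e t, fun n hn => ?_⟩⟩
  exact Finset.le_sup (f := fun t => h t n) ((hfin n).mem_toFinset.2 hn)

theorem exists_unbounded_family :
    ∃ F : Set (ℕ → ℕ), #F = boundingNumber ∧ ¬ ∃ g : ℕ → ℕ, ∀ f ∈ F, LEStar f g := by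
  have hne : {κ : Cardinal.{0} | ∃ F : Set (ℕ → ℕ), #F = κ ∧
      ¬ ∃ g : ℕ → ℕ, ∀ f ∈ F, LEStar f g}.Nonempty := by
    refine ⟨_, univ, rfl, ?_⟩
    rintro ⟨g, hg⟩
    obtain ⟨k, hk⟩ := hg (fun n => g n + 1) (mem_univ _)
    exact absurd (hk k le_rfl) (Nat.not_succ_le_self (g k))
  exact csInf_mem hne

theorem exists_dominating_family :
    ∃ F : Set (ℕ → ℕ), #F = dominatingNumber ∧ ∀ g : ℕ → ℕ, ∃ f ∈ F, LEStar g f := by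
  have hne : {κ : Cardinal.{0} | ∃ F : Set (ℕ → ℕ), #F = κ ∧
      ∀ g : ℕ → ℕ, ∃ f ∈ F, LEStar g f}.Nonempty :=
    ⟨_, univ, rfl, fun g => ⟨g, mem_univ _, LEStar.of_le fun _ => le_rfl⟩⟩
  exact csInf_mem hne

theorem lift_boundingNumber_le {ι : Type u} (φ : ι → ℕ → ℕ)
    (h : ¬ ∃ g : ℕ → ℕ, ∀ i, LEStar (φ i) g) : Cardinal.lift.{u} boundingNumber ≤ #ι := by
  have h₁ : boundingNumber ≤ #(range φ) :=
    csInf_le' ⟨range φ, rfl, fun ⟨g, hg⟩ => h ⟨g, fun i => hg _ (mem_range_self i)⟩⟩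
  have h₂ := Cardinal.mk_range_le_lift (f := φ)
  rw [Cardinal.lift_id'.{0, u}] at h₂
  exact (Cardinal.lift_le.2 h₁).trans h₂

theorem lift_dominatingNumber_le {ι : Type u} (φ : ι → ℕ → ℕ)
    (h : ∀ g : ℕ → ℕ, ∃ i, LEStar g (φ i)) : Cardinal.lift.{u} dominatingNumber ≤ #ι := by
  have h₁ : dominatingNumber ≤ #(range φ) :=
    csInf_le' ⟨range φ, rfl, fun g => (h g).elim fun i hi => ⟨_, mem_range_self i, hi⟩⟩
  have h₂ := Cardinal.mk_range_le_lift (f := φ)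
  rw [Cardinal.lift_id'.{0, u}] at h₂
  exact (Cardinal.lift_le.2 h₁).trans h₂

theorem mk_image_le_lift_of_eq {Y : Type u} {F : Set (ℕ → ℕ)} {κ : Cardinal.{0}} (hF : #F = κ)
    (φ : (ℕ → ℕ) → Y) : #(φ '' F) ≤ Cardinal.lift.{u} κ := by
  have h := Cardinal.mk_image_le_lift (f := φ) (s := F)
  rw [Cardinal.lift_id'.{0, u}] at h
  exact hF ▸ h

theorem minCard_eq {S : Set Cardinal.{u}} {κ : Cardinal.{u}} (h₁ : ∃ μ ∈ S, μ ≤ κ)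
    (h₂ : ∀ μ ∈ S, κ ≤ μ) : minCard S = κ := by
  obtain ⟨μ, hμ, hle⟩ := h₁
  rw [minCard, if_pos ⟨μ, hμ⟩]
  exact le_antisymm ((csInf_le' hμ).trans hle) (le_csInf ⟨μ, hμ⟩ h₂)

/-! ### Layered ideals -/

/-- The union over `s ∈ T` of the sets of points `y` whose index `e y` is at most the value of `f`
at the level `c s y` of `y`. -/
def layerSet {X S : Type*} (e : X → ℕ) (c : S → X → ℕ) (T : Finset S) (f : ℕ → ℕ) : Set X :=
  {y | ∃ s ∈ T, e y ≤ f (c s y)}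

/-- An ideal cofinally generated by the sets `layerSet e c T f`, together with an embedding `p` of
`ω × ω` under which regions below graphs lie in the ideal, while members of the ideal have finite
traces on almost all columns. -/
structure IsLayered {X S : Type*} (I : Set (Set X)) (e : X → ℕ) (c : S → X → ℕ)
    (p : ℕ × ℕ → X) : Prop where
  injective_index : Function.Injective e
  mono : ∀ {A B : Set X}, A ⊆ B → B ∈ I → A ∈ I
  layerSet_mem : ∀ T f, layerSet e c T f ∈ I
  exists_subset : ∀ A ∈ I, ∃ T f, A ⊆ layerSet e c T f
  injective_embed : Function.Injective p
  image_mem : ∀ f : ℕ → ℕ, p '' {x | x.2 ≤ f x.1} ∈ I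
  finite_columns : ∀ B ∈ I, ∃ m, ∀ i, m ≤ i → {j | p (i, j) ∈ B}.Finite

theorem mem_region (f : ℕ → ℕ) (i : ℕ) : (i, f i) ∈ {x : ℕ × ℕ | x.2 ≤ f x.1} :=
  le_refl (f i)

/-- A lost point has level below the threshold `k`, so its index is at most the maximum of `f` below
`k`; injectivity of the index leaves finitely many such points. -/
theorem layerSet_subsetStar {X S : Type*} {e : X → ℕ} (he : Function.Injective e)
    (c : S → X → ℕ) (T : Finset S) {f g : ℕ → ℕ} (h : LEStar f g) :
    SubsetStar (layerSet e c T f) (layerSet e c T g) := by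
  obtain ⟨k, hk⟩ := h
  refine ((finite_Iic ((Finset.range k).sup f)).preimage he.injOn).subset ?_
  rintro y ⟨⟨s, hs, hy⟩, hn⟩
  by_cases hc : k ≤ c s y
  · exact absurd ⟨s, hs, hy.trans (hk _ hc)⟩ hn
  · exact hy.trans (Finset.le_sup (f := f) (Finset.mem_range.2 (not_le.1 hc)))

namespace IsLayered

variable {X : Type u} {S : Type*} {I : Set (Set X)} {e : X → ℕ} {c : S → X → ℕ} {p : ℕ × ℕ → X}

theorem singleton_mem (h : IsLayered I e c p) (x : X) : {x} ∈ I := by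
  -- A nonempty member of the ideal is used only to produce some `s : S`.
  obtain ⟨T, f, hT⟩ := h.exists_subset _ (h.image_mem 0)
  obtain ⟨s, hs, -⟩ := hT (mem_image_of_mem p (mem_region 0 0))
  refine h.mono ?_ (h.layerSet_mem T fun _ => e x)
  rintro _ rfl
  exact ⟨s, hs, le_rfl⟩

theorem countable (h : IsLayered I e c p) : Countable X := h.injective_index.countable

/-- Members of `[I]^ω` must be infinite families, so countable ones are padded with singletons. -/
theorem exists_ctblInf_superset (h : IsLayered I e c p) {D : Set (Set X)} (hD : D ⊆ I)
    (hc : D.Countable) : ∃ B ∈ ctblInfSubsets I, D ⊆ B := by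
  have := h.countable
  have : Infinite X := Infinite.of_injective p h.injective_embed
  refine ⟨D ∪ range fun x : X => {x}, ⟨union_subset hD ?_, hc.union (countable_range _), ?_⟩,
    subset_union_left⟩
  · rintro _ ⟨x, rfl⟩
    exact h.singleton_mem x
  · exact (infinite_range_of_injective singleton_injective).mono subset_union_right

theorem exists_column_bound (h : IsLayered I e c p) {B : Set X} (hB : B ∈ I) :
    ∃ g : ℕ → ℕ, ∃ m, ∀ i j, m ≤ i → p (i, j) ∈ B → j ≤ g i := by
  obtain ⟨m, hm⟩ := h.finite_columns B hB
  have : ∀ i, ∃ b, m ≤ i → ∀ j, p (i, j) ∈ B → j ≤ b := by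
    intro i
    by_cases hi : m ≤ i
    · obtain ⟨b, hb⟩ := (hm i hi).bddAbove
      exact ⟨b, fun _ j hj => hb hj⟩
    · exact ⟨0, fun h => absurd h hi⟩
  choose g hg using this
  exact ⟨g, m, fun i j hi hj => hg i hi j hj⟩

theorem leStar_of_image_subsetStar (h : IsLayered I e c p) {B : Set X} {f g : ℕ → ℕ} {m : ℕ}
    (hg : ∀ i j, m ≤ i → p (i, j) ∈ B → j ≤ g i)
    (hs : SubsetStar (p '' {x | x.2 ≤ f x.1}) B) : LEStar f g := by
  have hfin : {i | p (i, f i) ∉ B}.Finite := by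
    refine Finite.of_injOn (f := fun i => p (i, f i)) (fun i hi => ?_) ?_ hs
    · exact ⟨mem_image_of_mem p (mem_region f i), hi⟩
    · intro i _ j _ hij
      exact congrArg Prod.fst (h.injective_embed hij)
  obtain ⟨k, hk⟩ := hfin.bddAbove
  refine ⟨max m (k + 1), fun n hn => hg n _ (le_trans (le_max_left _ _) hn) ?_⟩
  by_contra hc
  have := hk hc
  have := le_trans (le_max_right m (k + 1)) hn
  omega

/-- A countable subfamily of the ideal is dominated on the columns by a single function. -/
theorem exists_common_column_bound (h : IsLayered I e c p) {D : Set (Set X)}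
    (hD : D ∈ ctblInfSubsets I) :
    ∃ g : ℕ → ℕ, ∀ B ∈ D, ∃ m, ∀ i j, m ≤ i → p (i, j) ∈ B → j ≤ g i := by
  have := hD.2.1.to_subtype
  choose g m hg using fun B : D => h.exists_column_bound (hD.1 B.2)
  obtain ⟨g', hg'⟩ := exists_leStar_of_countable g
  refine ⟨g', fun B hB => ?_⟩
  obtain ⟨k, hk⟩ := hg' ⟨B, hB⟩
  exact ⟨max (m ⟨B, hB⟩) k, fun i j hi hj =>
    (hg ⟨B, hB⟩ i j (le_trans (le_max_left _ _) hi) hj).trans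
      (hk i (le_trans (le_max_right _ _) hi))⟩

/-- Countability of `S` matters here: there are only countably many finite `T`. -/
theorem exists_layerSet_family [Countable S] (h : IsLayered I e c p) (g : ℕ → ℕ) :
    ∃ B ∈ ctblInfSubsets I, ∀ T, layerSet e c T g ∈ B := by
  obtain ⟨B, hB, hs⟩ := h.exists_ctblInf_superset (D := range fun T => layerSet e c T g)
    (range_subset_iff.2 fun T => h.layerSet_mem T g) (countable_range _)
  exact ⟨B, hB, fun T => hs (mem_range_self T)⟩

theorem addOmega_eq [Countable S] (h : IsLayered I e c p) :
    addOmega I = Cardinal.lift.{u} boundingNumber := by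
  refine minCard_eq ?_ ?_
  · obtain ⟨F, hF, hub⟩ := exists_unbounded_family
    refine ⟨_, ⟨(fun f : ℕ → ℕ => p '' {x | x.2 ≤ f x.1}) '' F, rfl, ?_, ?_⟩,
      mk_image_le_lift_of_eq hF _⟩
    · rintro _ ⟨f, -, rfl⟩
      exact h.image_mem f
    · rintro ⟨D, hD, hcov⟩
      obtain ⟨g, hg⟩ := h.exists_common_column_bound hD
      refine hub ⟨g, fun f hf => ?_⟩
      obtain ⟨B, hB, hfB⟩ := hcov _ (mem_image_of_mem _ hf)
      obtain ⟨m, hm⟩ := hg B hB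
      exact h.leStar_of_image_subsetStar hm hfB
  · rintro _ ⟨A, rfl, hA, hno⟩
    choose T f hf using fun a : A => h.exists_subset a (hA a.2)
    refine lift_boundingNumber_le f ?_
    rintro ⟨g, hg⟩
    obtain ⟨B, hB, hT⟩ := h.exists_layerSet_family g
    refine hno ⟨B, hB, fun a ha => ⟨_, hT (T ⟨a, ha⟩), ?_⟩⟩
    exact (layerSet_subsetStar h.injective_index c _ (hg ⟨a, ha⟩)).subset
      (sdiff_subset_sdiff_left (hf ⟨a, ha⟩))

theorem cofOmega_eq [Countable S] (h : IsLayered I e c p) :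
    cofOmega I = Cardinal.lift.{u} dominatingNumber := by
  refine minCard_eq ?_ ?_
  · obtain ⟨F, hF, hdom⟩ := exists_dominating_family
    choose C hC hT using h.exists_layerSet_family
    refine ⟨_, ⟨C '' F, rfl, ?_, ?_⟩, mk_image_le_lift_of_eq hF _⟩
    · rintro _ ⟨f, -, rfl⟩
      exact hC f
    · intro D hD
      have := hD.2.1.to_subtype
      choose T φ hφ using fun B : D => h.exists_subset B (hD.1 B.2)
      obtain ⟨g, hg⟩ := exists_leStar_of_countable φ
      obtain ⟨f, hf, hgf⟩ := hdom g
      refine ⟨C f, mem_image_of_mem _ hf, fun B hB => ⟨_, hT f (T ⟨B, hB⟩), ?_⟩⟩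
      exact (layerSet_subsetStar h.injective_index c _ ((hg ⟨B, hB⟩).trans hgf)).subset
        (sdiff_subset_sdiff_left (hφ ⟨B, hB⟩))
  · rintro _ ⟨𝒜, rfl, h𝒜, hcof⟩
    choose φ hφ using fun C : 𝒜 => h.exists_common_column_bound (h𝒜 C.2)
    refine lift_dominatingNumber_le φ fun g => ?_
    obtain ⟨B, hB, hgB⟩ := h.exists_ctblInf_superset
      (singleton_subset_iff.2 (h.image_mem g)) (countable_singleton _)
    obtain ⟨C, hC, hBC⟩ := hcof B hB
    obtain ⟨A, hA, hs⟩ := hBC _ (hgB rfl)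
    obtain ⟨m, hm⟩ := hφ ⟨C, hC⟩ A hA
    exact ⟨⟨C, hC⟩, h.leStar_of_image_subsetStar hm hs⟩

/-- Some single layer contains infinitely many points of `A`, and their levels are unbounded. Choose
`y n ∈ A` of level at least `n` and let `φ n` be its index. If `φ n < g n` with `g` monotone, then
`y n` lies in the layer of `g`; a finite intersection bounds the levels of such points, hence `n`.
-/
theorem exists_escape_function (h : IsLayered I e c p) {A : Set X} (hA : A ∈ I)
    (hinf : A.Infinite) : ∃ s, ∃ φ : ℕ → ℕ, ∀ g : ℕ → ℕ, Monotone g →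
      (A ∩ layerSet e c {s} g).Finite → LEStar g φ := by
  obtain ⟨T, f, hT⟩ := h.exists_subset A hA
  obtain ⟨s, hs⟩ : ∃ s, {y | y ∈ A ∧ e y ≤ f (c s y)}.Infinite := by
    by_contra! hc
    refine hinf ((T.finite_toSet.biUnion fun s _ => hc s).subset fun y hy => ?_)
    obtain ⟨s, hs, hys⟩ := hT hy
    exact mem_biUnion hs ⟨hy, hys⟩
  have hex : ∀ n, ∃ y ∈ A, n ≤ c s y := by
    intro n
    by_contra! hc
    refine hs (((finite_Iic ((Finset.range n).sup f)).preimage h.injective_index.injOn).subset ?_)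
    rintro y ⟨hyA, hy⟩
    exact hy.trans (Finset.le_sup (f := f) (Finset.mem_range.2 (hc y hyA)))
  choose y hyA hyc using hex
  refine ⟨s, fun n => e (y n), fun g hg hfin => ?_⟩
  obtain ⟨M, hM⟩ := (hfin.image (c s)).bddAbove
  refine ⟨M + 1, fun n hn => ?_⟩
  by_contra! hlt
  have hmem : y n ∈ A ∩ layerSet e c {s} g :=
    ⟨hyA n, s, Finset.mem_singleton_self s, hlt.le.trans (hg (hyc n))⟩
  have := hM (mem_image_of_mem (c s) hmem)
  have := hyc n
  omega

theorem nonOmega_eq [Countable S] (h : IsLayered I e c p) :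
    nonOmega I = Cardinal.lift.{u} dominatingNumber := by
  have := h.countable
  refine minCard_eq ?_ ?_
  · obtain ⟨F, hF, hdom⟩ := exists_dominating_family
    -- The `+ 1` puts the graph strictly above any column bound that `f` dominates.
    refine ⟨_, ⟨(fun f : ℕ → ℕ => range fun i => p (i, f i + 1)) '' F, rfl, ?_, ?_⟩,
      mk_image_le_lift_of_eq hF _⟩
    · rintro _ ⟨f, -, rfl⟩
      refine ⟨⟨subset_univ _, to_countable _, infinite_range_of_injective fun i j hij =>
        congrArg Prod.fst (h.injective_embed hij)⟩, h.mono ?_ (h.image_mem fun i => f i + 1)⟩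
      rintro _ ⟨i, rfl⟩
      exact mem_image_of_mem p (mem_region (fun i => f i + 1) i)
    · intro D hD
      obtain ⟨g, hg⟩ := h.exists_common_column_bound hD
      obtain ⟨f, hf, k, hk⟩ := hdom g
      refine ⟨_, mem_image_of_mem _ hf, fun B hB => ?_⟩
      obtain ⟨m, hm⟩ := hg B hB
      refine ((finite_Iio (max m k)).image fun i => p (i, f i + 1)).subset ?_
      rintro _ ⟨⟨i, rfl⟩, hi⟩
      refine mem_image_of_mem _ (mem_Iio.2 (not_le.1 fun hle => ?_))
      have h₁ := hm i _ (le_trans (le_max_left _ _) hle) hi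
      have h₂ := hk i (le_trans (le_max_right _ _) hle)
      omega
  · rintro _ ⟨𝒜, rfl, h𝒜, hnon⟩
    choose s φ hφ using fun A : 𝒜 => h.exists_escape_function (h𝒜 A.2).2 (h𝒜 A.2).1.2.2
    refine lift_dominatingNumber_le φ fun g => ?_
    -- `partialSups g` is a monotone majorant of `g`, as the escape function requires.
    obtain ⟨B, hB, hT⟩ := h.exists_layerSet_family (partialSups g)
    obtain ⟨A, hA, hAB⟩ := hnon B hB
    exact ⟨⟨A, hA⟩, (LEStar.of_le (le_partialSups g)).trans
      (hφ ⟨A, hA⟩ _ (partialSups g).monotone (hAB _ (hT _)))⟩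

end IsLayered

/-! ### The ideal `{∅} ⊗ FIN` -/

theorem isLayered_emptyTensorFin : IsLayered emptyTensorFin (Encodable.encode : ℕ × ℕ → ℕ)
    (fun (_ : Unit) x => x.1) id where
  injective_index := Encodable.encode_injective
  mono hAB hB i := (hB i).subset fun _ hj => hAB hj
  layerSet_mem T f i := by
    refine Finite.of_injOn (f := fun j => Encodable.encode (i, j)) ?_ ?_ (finite_Iic (f i))
    · intro j hj
      exact hj.elim fun _ h => h.2
    · intro j _ k _ hjk
      exact congrArg Prod.snd (Encodable.encode_injective hjk)
  exists_subset A hA := by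
    have : ∀ i, ∃ b, ∀ j, (i, j) ∈ A → Encodable.encode (i, j) ≤ b := by
      intro i
      obtain ⟨b, hb⟩ := ((hA i).image fun j => Encodable.encode (i, j)).bddAbove
      exact ⟨b, fun j hj => hb (mem_image_of_mem _ hj)⟩
    choose f hf using this
    exact ⟨{()}, f, fun x hx => ⟨(), Finset.mem_singleton_self _, hf x.1 x.2 hx⟩⟩
  injective_embed := Function.injective_id
  image_mem f i := by
    rw [image_id]
    exact finite_Iic (f i)
  finite_columns B hB := ⟨0, fun i _ => hB i⟩

/-! ### Convergence ideals of countable spaces -/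

theorem exists_seq_of_finite_diff {X : Type*} [TopologicalSpace X] {e : X → ℕ}
    (he : Function.Injective e) {A : Set X} {x : X} (hA : ∀ U ∈ 𝓝 x, (A \ U).Finite) :
    ∃ d : ℕ → X, Tendsto d atTop (𝓝 x) ∧ A ⊆ range d := by
  classical
  -- Unused indices take the value `x`, which does not disturb convergence and covers finite or
  -- empty `A`.
  refine ⟨fun k => if h : ∃ y ∈ A, e y = k then h.choose else x, ?_, fun y hy => ⟨e y, ?_⟩⟩
  · intro U hU
    obtain ⟨M, hM⟩ := ((hA U hU).image e).bddAbove
    refine mem_map.2 (mem_atTop_sets.2 ⟨M + 1, fun k hk => ?_⟩)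
    rw [mem_preimage]
    split_ifs with h
    · by_contra hn
      have := hM (mem_image_of_mem e ⟨h.choose_spec.1, hn⟩)
      have := h.choose_spec.2
      omega
    · exact mem_of_mem_nhds hU
  · have h : ∃ z ∈ A, e z = e y := ⟨y, hy, rfl⟩
    simp only [dif_pos h]
    exact he h.choose_spec.2

theorem mem_convIdeal_of_finite_diff {X ι : Type*} [TopologicalSpace X] [Countable X]
    (T : Finset ι) (A : ι → Set X) (x : ι → X)
    (hA : ∀ i ∈ T, ∀ U ∈ 𝓝 (x i), (A i \ U).Finite) :
    (⋃ i ∈ T, A i) ∈ convIdeal (univ : Set X) := by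
  obtain ⟨e, he⟩ := exists_injective_nat X
  choose d hd hAd using fun i : T => exists_seq_of_finite_diff he (hA i i.2)
  refine ⟨subset_univ _, T.card, fun k => d (T.equivFin.symm k), fun _ _ => mem_univ _,
    fun k => ⟨_, hd (T.equivFin.symm k)⟩, ?_⟩
  refine iUnion₂_subset fun i hi => (hAd ⟨i, hi⟩).trans ?_
  refine subset_iUnion_of_subset (T.equivFin ⟨i, hi⟩) ?_
  simp

theorem finite_range_diff_of_tendsto {X : Type*} [TopologicalSpace X] {d : ℕ → X} {x : X}
    (hd : Tendsto d atTop (𝓝 x)) {U : Set X} (hU : U ∈ 𝓝 x) : (range d \ U).Finite := by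
  obtain ⟨N, hN⟩ := mem_atTop_sets.1 (mem_map.1 (hd hU))
  refine ((finite_Iio N).image d).subset ?_
  rintro _ ⟨⟨k, rfl⟩, hk⟩
  exact mem_image_of_mem d (not_le.1 fun h => hk (hN k h))

/-- Every point of a first-countable T₁ space has a level function whose sublevel sets, with the
point added, form a basis of complements of its neighbourhoods. -/
theorem exists_level_function {X : Type*} [TopologicalSpace X] [FirstCountableTopology X]
    [T1Space X] (x : X) : ∃ c : X → ℕ,
      (∀ n, ({x}ᶜ ∩ {y | c y ≤ n})ᶜ ∈ 𝓝 x) ∧ ∀ U ∈ 𝓝 x, ∃ n, ∀ y, y ∉ U → c y ≤ n := by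
  classical
  obtain ⟨U, hU⟩ := (𝓝 x).exists_antitone_basis
  have hex : ∀ y, y ≠ x → ∃ n, y ∉ U n := by
    intro y hy
    obtain ⟨n, -, hn⟩ := hU.1.mem_iff.1 (isOpen_compl_singleton.mem_nhds hy.symm)
    exact ⟨n, fun h => hn h rfl⟩
  -- The level is the first basic neighbourhood missing `y`; the default `0` occurs only at `y = x`.
  refine ⟨fun y => if h : ∃ n, y ∉ U n then Nat.find h else 0, fun n => ?_, fun V hV => ?_⟩
  · refine mem_of_superset (hU.1.mem_of_mem (i := n) trivial) ?_
    rintro y hy ⟨hyx, hyn⟩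
    have h := hex y hyx
    simp only [mem_ofPred_eq, dif_pos h] at hyn
    exact Nat.find_spec h (hU.2 hyn hy)
  · obtain ⟨n, -, hn⟩ := hU.1.mem_iff.1 hV
    refine ⟨n, fun y hy => ?_⟩
    have hyn : y ∉ U n := fun h => hy (hn h)
    have h : ∃ n, y ∉ U n := ⟨n, hyn⟩
    simp only [dif_pos h]
    exact Nat.find_min' h hyn

/-- The convergence ideal of a countable first-countable Hausdorff space is layered as soon as the
space contains a sequence of columns converging to distinct points and, together, to a point. -/
theorem exists_isLayered_convIdeal {X : Type*} [TopologicalSpace X] [Countable X]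
    [FirstCountableTopology X] [T2Space X] {p : ℕ × ℕ → X} (hp : Function.Injective p)
    {q : ℕ → X} (hq : Function.Injective q)
    (hpq : ∀ i, Tendsto (fun j => p (i, j)) atTop (𝓝 (q i))) {z : X}
    (hz : ∀ U ∈ 𝓝 z, ∃ m, ∀ i j, m ≤ i → p (i, j) ∈ U) :
    ∃ (e : X → ℕ) (c : X → X → ℕ), IsLayered (convIdeal (univ : Set X)) e c p := by
  obtain ⟨e, he⟩ := exists_injective_nat X
  choose c hc₁ hc₂ using exists_level_function (X := X)
  refine ⟨e, c, he, ?_, fun T f => ?_, ?_, hp, fun f => ?_, ?_⟩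
  · rintro A B hAB ⟨-, k, d, h₁, h₂, h₃⟩
    exact ⟨subset_univ _, k, d, h₁, h₂, hAB.trans h₃⟩
  · have h := mem_convIdeal_of_finite_diff T (fun x => {y | e y ≤ f (c x y)}) id ?_
    · convert h using 1
      ext y
      simp [layerSet]
    · intro x _ U hU
      obtain ⟨n, hn⟩ := hc₂ x U hU
      refine ((finite_Iic ((Finset.range (n + 1)).sup f)).preimage he.injOn).subset ?_
      rintro y ⟨hy, hyU⟩
      exact le_trans hy (Finset.le_sup (f := f)
        (Finset.mem_range.2 (Nat.lt_succ_of_le (hn y hyU))))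
  · classical
    rintro A ⟨-, k, d, -, hx, hA⟩
    choose x hx using hx
    have hb : ∀ i n, ∃ b, ∀ y ∈ range (d i), c (x i) y = n → e y ≤ b := by
      intro i n
      obtain ⟨b, hb⟩ := (((finite_range_diff_of_tendsto (hx i) (hc₁ (x i) n)).union
        (finite_singleton (x i))).image e).bddAbove
      refine ⟨b, fun y hy hn => hb (mem_image_of_mem e ?_)⟩
      by_cases hyx : y = x i
      · exact Or.inr hyx
      · exact Or.inl ⟨hy, fun h => h ⟨hyx, hn.le⟩⟩
    choose b hb using hb
    refine ⟨Finset.univ.image x, fun n => Finset.univ.sup fun i => b i n, fun y hy => ?_⟩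
    obtain ⟨i, hi⟩ := mem_iUnion.1 (hA hy)
    refine ⟨x i, Finset.mem_image_of_mem x (Finset.mem_univ i), (hb i _ y hi rfl).trans ?_⟩
    exact Finset.le_sup (f := fun l => b l (c (x i) y)) (Finset.mem_univ i)
  -- The whole region converges to `z`: a neighbourhood of `z` omits points from only finitely many
  -- columns, each finite below the graph.
  · have h := mem_convIdeal_of_finite_diff {()} (fun _ : Unit => p '' {x | x.2 ≤ f x.1}) (fun _ => z) ?_
    · simpa only [Finset.mem_singleton, iUnion_true, iUnion_const] using h
    · intro _ _ U hU
      obtain ⟨m, hm⟩ := hz U hU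
      refine (((finite_Iio m).prod (finite_Iic ((Finset.range m).sup f))).image p).subset ?_
      rintro _ ⟨⟨⟨i, j⟩, hij, rfl⟩, hn⟩
      have hi : i < m := not_le.1 fun h => hn (hm i j h)
      exact mem_image_of_mem p ⟨hi, le_trans hij (Finset.le_sup (f := f) (Finset.mem_range.2 hi))⟩
  · rintro B ⟨-, k, d, -, hx, hB⟩
    choose x hx using hx
    -- All but finitely many columns have a limit different from every `x l`; Hausdorff separation
    -- then makes their traces on each sequence finite.
    have hfin : {i | q i ∈ range x}.Finite := (finite_range x).preimage hq.injOn
    obtain ⟨m, hm⟩ := hfin.bddAbove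
    refine ⟨m + 1, fun i hi => ?_⟩
    have hne : ∀ l, q i ≠ x l := by
      intro l hl
      have := hm (show i ∈ {i | q i ∈ range x} from ⟨l, hl.symm⟩)
      omega
    have hcol : ∀ l, {j | p (i, j) ∈ range (d l)}.Finite := by
      intro l
      obtain ⟨V, U, hV, hU, hVU⟩ := t2_separation_nhds (hne l)
      have h₁ : {j | p (i, j) ∉ V}.Finite := by
        obtain ⟨N, hN⟩ := mem_atTop_sets.1 (mem_map.1 (hpq i hV))
        exact (finite_Iio N).subset fun j hj => not_le.1 fun h => hj (hN j h)
      have h₂ : {j | p (i, j) ∈ range (d l) \ U}.Finite :=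
        (finite_range_diff_of_tendsto (hx l) hU).preimage
          fun j _ j' _ h => congrArg Prod.snd (hp h)
      refine (h₁.union h₂).subset fun j hj => ?_
      by_cases hjV : p (i, j) ∈ V
      · exact Or.inr ⟨hj, fun h => disjoint_left.1 hVU hjV h⟩
      · exact Or.inl hjV
    refine (finite_iUnion hcol).subset fun j hj => ?_
    obtain ⟨l, hl⟩ := mem_iUnion.1 (hB hj)
    exact mem_iUnion.2 ⟨l, hl⟩

/-! ### The spaces `ω ^ α + 1` -/

theorem countable_omegaPowSucc {α : Ordinal.{0}} (hα : α < ω₁) : Countable (OmegaPowSucc α) := by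
  have hα' : α.card ≤ ℵ₀ := by
    rwa [← Cardinal.ord_aleph, Cardinal.lt_ord, ← Cardinal.succ_aleph0, Order.lt_succ_iff] at hα
  have hcard : ((ω : Ordinal.{0}) ^ α).card ≤ ℵ₀ := by
    refine (Ordinal.card_opow_le ω α).trans ?_
    simp [hα']
  have hc : (Iio ((ω : Ordinal.{0}) ^ α)).Countable := by
    rw [← Cardinal.le_aleph0_iff_set_countable, Cardinal.mk_Iio_ordinal]
    exact Cardinal.lift_le_aleph0.2 hcard
  rw [OmegaPowSucc, ← Iio_insert]
  exact (hc.insert _).to_subtype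

theorem omega0_mul_add_lt_sq (i j : ℕ) : ω * (i : Ordinal.{0}) + j < ω ^ (2 : Ordinal.{0}) := by
  rw [← one_add_one_eq_two, Ordinal.opow_add, Ordinal.opow_one]
  exact Ordinal.lt_mul_iff.2
    ⟨i, Ordinal.natCast_lt_omega0 i, j, Ordinal.natCast_lt_omega0 j, rfl⟩

theorem omega0_mul_add_injective {i j k l : ℕ}
    (h : ω * (i : Ordinal.{0}) + j = ω * (k : Ordinal.{0}) + l) : i = k ∧ j = l := by
  constructor
  · have := congrArg (· / ω) h
    simpa [Ordinal.mul_add_div _ Ordinal.omega0_ne_zero,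
      Ordinal.div_eq_zero_of_lt (Ordinal.natCast_lt_omega0 _)] using this
  · have := congrArg (· % ω) h
    simpa [Ordinal.mul_add_mod_self, Ordinal.natCast_mod_omega0] using this

/-- The `i`-th column of isolated points of `ω ^ 2` converges to `ω * (i + 1)`. -/
theorem exists_lt_omega0_mul_add {a : Ordinal.{0}} {i : ℕ}
    (ha : a < ω * ((i + 1 : ℕ) : Ordinal.{0}) + (0 : ℕ)) :
    ∃ m : ℕ, ∀ j, m ≤ j → a < ω * (i : Ordinal.{0}) + (j + 1 : ℕ) := by
  rw [Nat.cast_zero, add_zero, Nat.cast_succ, mul_add_one,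
    Ordinal.lt_add_iff_of_isSuccLimit Ordinal.isSuccLimit_omega0] at ha
  obtain ⟨b, hb, hab⟩ := ha
  obtain ⟨m, rfl⟩ := Ordinal.lt_omega0.1 hb
  refine ⟨m, fun j hj => hab.trans_le ?_⟩
  gcongr
  omega

theorem exists_lt_omega0_sq {a : Ordinal.{0}} (ha : a < ω ^ (2 : Ordinal.{0})) :
    ∃ m : ℕ, ∀ i j : ℕ, m ≤ i → a < ω * (i : Ordinal.{0}) + (j + 1 : ℕ) := by
  rw [← one_add_one_eq_two, Ordinal.opow_add, Ordinal.opow_one,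
    Ordinal.lt_mul_iff_of_isSuccLimit Ordinal.isSuccLimit_omega0] at ha
  obtain ⟨b, hb, hab⟩ := ha
  obtain ⟨m, rfl⟩ := Ordinal.lt_omega0.1 hb
  refine ⟨m, fun i j hi => hab.trans_le (le_add_right ?_)⟩
  gcongr

theorem exists_isLayered_convAlpha {α : Ordinal.{0}} (h2 : 2 ≤ α) (hα : α < ω₁) :
    ∃ (e : OmegaPowSucc α → ℕ) (c : OmegaPowSucc α → OmegaPowSucc α → ℕ)
      (p : ℕ × ℕ → OmegaPowSucc α), IsLayered (convAlpha α) e c p := by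
  have := countable_omegaPowSucc hα
  have hsq : (ω : Ordinal.{0}) ^ (2 : Ordinal.{0}) ≤ ω ^ α :=
    Ordinal.opow_le_opow_right Ordinal.omega0_pos h2
  have hle : ∀ i j : ℕ, ω * (i : Ordinal.{0}) + j ≤ ω ^ α := fun i j =>
    (omega0_mul_add_lt_sq i j).le.trans hsq
  have : SecondCountableTopology (OmegaPowSucc α) := by
    refine ⟨{s | ∃ a, s = Ioi a ∨ s = Iio a}, ?_, OrderTopology.topology_eq_generate_intervals⟩
    refine ((countable_range Ioi).union (countable_range Iio)).mono ?_
    rintro _ ⟨a, rfl | rfl⟩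
    exacts [Or.inl (mem_range_self a), Or.inr (mem_range_self a)]
  -- The columns lie in the initial segment `ω ^ 2 + 1`, which is available because `2 ≤ α`. The
  -- summand `0` in `q` gives it the form used by `omega0_mul_add_injective`.
  refine (exists_isLayered_convIdeal (X := OmegaPowSucc α)
    (p := fun x => ⟨ω * (x.1 : Ordinal.{0}) + (x.2 + 1 : ℕ), hle _ _⟩)
    (q := fun i => ⟨ω * ((i + 1 : ℕ) : Ordinal.{0}) + (0 : ℕ), hle _ _⟩)
    (z := ⟨ω ^ (2 : Ordinal.{0}), hsq⟩) ?_ ?_ ?_ ?_).imp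
    fun _ h => h.imp fun _ h => ⟨_, h⟩
  · rintro ⟨i, j⟩ ⟨k, l⟩ h
    have := omega0_mul_add_injective (congrArg Subtype.val h)
    exact Prod.ext this.1 (Nat.succ_injective this.2)
  · intro i k h
    have := omega0_mul_add_injective (congrArg Subtype.val h)
    omega
  · intro i
    refine tendsto_order.2 ⟨fun a ha => ?_, fun a ha => Eventually.of_forall fun j => ?_⟩
    · obtain ⟨m, hm⟩ := exists_lt_omega0_mul_add (Subtype.coe_lt_coe.2 ha)
      exact eventually_atTop.2 ⟨m, fun j hj => hm j hj⟩
    · refine lt_of_le_of_lt (Subtype.coe_le_coe.1 ?_) ha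
      dsimp only
      rw [Nat.cast_zero, add_zero, Nat.cast_succ i, mul_add_one]
      gcongr
      exact (Ordinal.natCast_lt_omega0 _).le
  · intro U hU
    have hpos : (⟨0, mem_Iic.2 zero_le⟩ : OmegaPowSucc α) < ⟨ω ^ (2 : Ordinal.{0}), hsq⟩ :=
      Subtype.coe_lt_coe.1 (Ordinal.opow_pos _ Ordinal.omega0_pos)
    obtain ⟨a, ha, haU⟩ := exists_Ioc_subset_of_mem_nhds hU ⟨_, hpos⟩
    obtain ⟨m, hm⟩ := exists_lt_omega0_sq (Subtype.coe_lt_coe.2 ha)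
    exact ⟨m, fun i j hi => haU ⟨hm i j hi, (omega0_mul_add_lt_sq i (j + 1)).le⟩⟩

theorem mainTheorem4 :
    (addOmega emptyTensorFin = boundingNumber ∧
      cofOmega emptyTensorFin = dominatingNumber ∧
      nonOmega emptyTensorFin = dominatingNumber) ∧
    ∀ α : Ordinal.{0}, 2 ≤ α → α < ω₁ →
      addOmega (convAlpha α) = Cardinal.lift.{1} boundingNumber ∧
      cofOmega (convAlpha α) = Cardinal.lift.{1} dominatingNumber ∧
      nonOmega (convAlpha α) = Cardinal.lift.{1} dominatingNumber := by
  refine ⟨?_, fun α h2 hα => ?_⟩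
  · have h := isLayered_emptyTensorFin
    refine ⟨?_, ?_, ?_⟩
    · simpa using h.addOmega_eq
    · simpa using h.cofOmega_eq
    · simpa using h.nonOmega_eq
  · have := countable_omegaPowSucc hα
    obtain ⟨e, c, p, h⟩ := exists_isLayered_convAlpha h2 hα
    exact ⟨h.addOmega_eq, h.cofOmega_eq, h.nonOmega_eq⟩
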